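/- Let $(W,S)$ be a Coxeter system with $S$ finite and Coxeter matrix $(m_{st})_{s,t\in S}$. A reduced expression (reduced decomposition) of $w\in W$ is a word in the alphabet $S$ of minimal length among the words representing $w$. An element $w\in W$ is called fully commutative if any reduced expression of $w$ can be obtained from any other one by repeatedly exchanging adjacent letters $s,t$ with $m_{st}=2$; it is called cyclically fully commutative (CFC) if every cyclic shift of every reduced expression of $w$ is a reduced expression of a fully commutative element (which may differ from $w$). Let $a_n$ be the number of words of length $n$ that are reduced expressions of CFC elements of $W$ (words are counted, not elements). Then the generating series $\sum_{n\ge 0} a_n x^n$ is rational, that is, it equals $P(x)/Q(x)$ for some polynomials $P,Q\in\mathbb{Q}[x]$ with $Q(0)\neq 0$. -/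

import Mathlib

namespace CoxeterSystem

variable {B W : Type*} [Group W] {M : CoxeterMatrix B} (cs : CoxeterSystem M W)

/-- The set `R(w)` of reduced expressions of `w`. -/
def reducedWords (w : W) : Set (List B) :=
  {ω | cs.IsReduced ω ∧ cs.wordProd ω = w}

/-- One application of a commutation relation: two adjacent letters `s`, `t` with `m_{st} = 2`
are exchanged. -/
def CommStep (M : CoxeterMatrix B) (ω ω' : List B) : Prop :=
  ∃ (u v : List B) (s t : B), M s t = 2 ∧ ω = u ++ s :: t :: v ∧ ω' = u ++ t :: s :: v

/-- Two words are commutation equivalent if one can go from one to the other by a finite sequence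
of commutation relations. -/
def CommEquiv (M : CoxeterMatrix B) : List B → List B → Prop :=
  Relation.ReflTransGen (CommStep M)

/-- `w` is fully commutative: any reduced expression of `w` can be obtained from any other one by
using only commutation relations. -/
def IsFullyCommutative (w : W) : Prop :=
  ∀ ω ∈ cs.reducedWords w, ∀ ω' ∈ cs.reducedWords w, CommEquiv M ω ω'

/-- `w` is cyclically fully commutative: every cyclic shift of every reduced expression of `w` is a
reduced expression of some fully commutative element. -/
def IsCyclicallyFullyCommutative (w : W) : Prop :=
  ∀ ω ∈ cs.reducedWords w, ∀ ω' : List B, ω.IsRotated ω' →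
    cs.IsReduced ω' ∧ cs.IsFullyCommutative (cs.wordProd ω')

/-- The set of all reduced expressions of cyclically fully commutative elements. -/
def cfcWords : Set (List B) :=
  {ω | ∃ w : W, cs.IsCyclicallyFullyCommutative w ∧ ω ∈ cs.reducedWords w}

end CoxeterSystem

/-- The length generating series `∑ₙ #{ω ∈ L : |ω| = n} xⁿ` of a set `L` of words. (For words on
a finite alphabet all these sets are finite.) -/
noncomputable def wordGeneratingSeries {B : Type*} (L : Set (List B)) : PowerSeries ℚ :=
  PowerSeries.mk fun n => (({ω ∈ L | ω.length = n} : Set (List B)).ncard : ℚ)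

/-- A formal power series is rational if it is a quotient `P / Q` of two polynomials, where `Q` has
nonzero constant term. -/
def PowerSeries.IsRationalSeries {K : Type*} [Field K] (F : PowerSeries K) : Prop :=
  ∃ P Q : Polynomial K, Q.coeff 0 ≠ 0 ∧ (Q : PowerSeries K) * F = (P : PowerSeries K)

/-! A language over a finite alphabet with finitely many left quotients has a rational generating
series, by the transfer-matrix method (`HasFiniteQuotients.isRationalSeries`). So it is enough that
the CFC words form such a language.

On the Coxeter side, a word is a reduced expression of a fully commutative element iff no
commutation-equivalent word has a factor `ss` or a braid word of length `m_st ≥ 3`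
(`mem_fcWords_iff`). Hence a word fails to be CFC exactly when it is equivalent to some `uv` such
that `vu` is equivalent to a word with a forbidden factor (`cfcWords_eq_compl`). The criterion rests
on the exchange property, obtained from a signed conjugation action of `W`, and on `s_i s_j` having
order exactly `m_ij`, obtained from the geometric representation.

On the language side, concatenating two commutation-closed regular languages and closing under
commutations gives a regular language (`hasFiniteQuotients_commConcat`). There are finitely many
forbidden words, so the bad words form a regular language `G`. Rotation preserves regularity because
`vu ∈ G` says that `u` lies in the quotient of `G` by `v`, and only finitely many quotients occur
(`hasFiniteQuotients_rotation`). -/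

/-- A set of words with finitely many left quotients, that is, a regular language. -/
def HasFiniteQuotients {α : Type*} (K : Set (List α)) : Prop :=
  (Set.range fun x : List α => {y | x ++ y ∈ K}).Finite

/-! ### Regular languages through their left quotients. -/

namespace HasFiniteQuotients

variable {α : Type*}

theorem compl {K : Set (List α)} (hK : HasFiniteQuotients K) : HasFiniteQuotients Kᶜ := by
  refine (Set.Finite.image (fun L => Lᶜ) hK).subset ?_
  rintro _ ⟨x, rfl⟩
  exact ⟨{y | x ++ y ∈ K}, ⟨x, rfl⟩, rfl⟩

theorem iUnion {ι : Type*} [Finite ι] {K : ι → Set (List α)}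
    (hK : ∀ i, HasFiniteQuotients (K i)) : HasFiniteQuotients (⋃ i, K i) := by
  refine ((Set.Finite.pi' hK).image fun f => ⋃ i, f i).subset ?_
  rintro _ ⟨x, rfl⟩
  refine ⟨fun i => {y | x ++ y ∈ K i}, fun i => ⟨x, rfl⟩, ?_⟩
  ext y
  simp

/-- A union of members of a finite family, each of whose members is carried into the family by
taking one letter off, has finitely many quotients. -/
theorem of_family {𝓕 : Set (Set (List α))} (h𝓕 : 𝓕.Finite)
    (hstep : ∀ L ∈ 𝓕, ∀ a y, a :: y ∈ L → ∃ L' ∈ 𝓕, y ∈ L' ∧ ∀ z ∈ L', a :: z ∈ L)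
    {K : Set (List α)} (hK : K ∈ 𝓕) : HasFiniteQuotients K := by
  have hsteps : ∀ x : List α, ∀ L ∈ 𝓕, ∀ y, x ++ y ∈ L →
      ∃ L' ∈ 𝓕, y ∈ L' ∧ ∀ z ∈ L', x ++ z ∈ L := by
    intro x
    induction x with
    | nil => exact fun L hL y hy => ⟨L, hL, hy, fun z hz => hz⟩
    | cons a x ih =>
      intro L hL y hy
      obtain ⟨L₁, hL₁, hy₁, h₁⟩ := hstep L hL a (x ++ y) hy
      obtain ⟨L₂, hL₂, hy₂, h₂⟩ := ih L₁ hL₁ y hy₁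
      exact ⟨L₂, hL₂, hy₂, fun z hz => h₁ _ (h₂ z hz)⟩
  -- Subset construction: the quotient by `x` is the union of those members `L` with `xL ⊆ K`, and a
  -- finite family has finitely many unions.
  refine (h𝓕.finite_subsets.image Set.sUnion).subset ?_
  rintro _ ⟨x, rfl⟩
  refine ⟨{L ∈ 𝓕 | ∀ z ∈ L, x ++ z ∈ K}, fun L hL => hL.1, ?_⟩
  ext y
  constructor
  · rintro ⟨L, hL, hy⟩
    exact hL.2 y hy
  · intro hy
    obtain ⟨L, hL, hyL, h⟩ := hsteps x K hK y hy
    exact ⟨L, ⟨hL, h⟩, hyL⟩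

theorem univ : HasFiniteQuotients (Set.univ : Set (List α)) :=
  of_family (𝓕 := {Set.univ}) (Set.finite_singleton _) (by simp) rfl

theorem of_finite {K : Set (List α)} (hK : K.Finite) : HasFiniteQuotients K := by
  have hfin : (⋃ x ∈ K, {y | y <:+ x}).Finite := by
    refine hK.biUnion fun x _ => ?_
    refine (List.finite_toSet x.tails).subset fun y hy => ?_
    simpa using hy
  refine hfin.finite_subsets.subset ?_
  rintro _ ⟨x, rfl⟩ y hy
  exact Set.mem_biUnion hy ⟨x, rfl⟩

theorem quotient {K : Set (List α)} (hK : HasFiniteQuotients K) (x : List α) :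
    HasFiniteQuotients {y | x ++ y ∈ K} := by
  refine hK.subset ?_
  rintro _ ⟨z, rfl⟩
  exact ⟨x ++ z, by ext; simp⟩

/-- The quotient by `x` of this fibre depends on `x` only through the quotient of `K` by `x`. -/
theorem quotientFiber {K : Set (List α)} (hK : HasFiniteQuotients K) (q : Set (List α)) :
    HasFiniteQuotients {v | {y | v ++ y ∈ K} = q} := by
  refine (hK.image fun q' => {y | {z | y ++ z ∈ q'} = q}).subset ?_
  rintro _ ⟨x, rfl⟩
  refine ⟨_, ⟨x, rfl⟩, ?_⟩
  ext
  simp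

end HasFiniteQuotients

/-! ### Commutation equivalence of words. -/

namespace CoxeterSystem

variable {B : Type*} {M : CoxeterMatrix B}

theorem CommStep.symm {ω ω' : List B} (h : CommStep M ω ω') : CommStep M ω' ω := by
  obtain ⟨u, v, s, t, hst, rfl, rfl⟩ := h
  exact ⟨u, v, t, s, by rwa [M.symmetric], rfl, rfl⟩

theorem CommEquiv.refl (ω : List B) : CommEquiv M ω ω := Relation.ReflTransGen.refl

theorem CommEquiv.trans {ω₁ ω₂ ω₃ : List B} (h : CommEquiv M ω₁ ω₂) (h' : CommEquiv M ω₂ ω₃) :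
    CommEquiv M ω₁ ω₃ := Relation.ReflTransGen.trans h h'

theorem CommEquiv.symm {ω ω' : List B} (h : CommEquiv M ω ω') : CommEquiv M ω' ω := by
  induction h with
  | refl => exact CommEquiv.refl _
  | tail _ h ih => exact (Relation.ReflTransGen.single h.symm).trans ih

theorem CommEquiv.append_left (u : List B) {ω ω' : List B} (h : CommEquiv M ω ω') :
    CommEquiv M (u ++ ω) (u ++ ω') := by
  refine Relation.ReflTransGen.lift (u ++ ·) ?_ _ _ h
  rintro _ _ ⟨x, y, s, t, hst, rfl, rfl⟩
  exact ⟨u ++ x, y, s, t, hst, by simp, by simp⟩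

theorem CommEquiv.append_right (u : List B) {ω ω' : List B} (h : CommEquiv M ω ω') :
    CommEquiv M (ω ++ u) (ω' ++ u) := by
  refine Relation.ReflTransGen.lift (· ++ u) ?_ _ _ h
  rintro _ _ ⟨x, y, s, t, hst, rfl, rfl⟩
  exact ⟨x, y ++ u, s, t, hst, by simp, by simp⟩

theorem CommEquiv.length_eq {ω ω' : List B} (h : CommEquiv M ω ω') : ω.length = ω'.length := by
  induction h with
  | refl => rfl
  | tail _ h ih =>
    obtain ⟨u, v, s, t, -, rfl, rfl⟩ := h
    simpa using ih

theorem CommEquiv.swap {s t : B} (h : M s t = 2) (u v : List B) :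
    CommEquiv M (u ++ s :: t :: v) (u ++ t :: s :: v) :=
  Relation.ReflTransGen.single ⟨u, v, s, t, h, rfl, rfl⟩

/-- A letter moves to the front past letters that commute with it. -/
theorem CommEquiv.append_cons {a : B} {p : List B} (hp : ∀ c ∈ p, M a c = 2) (q : List B) :
    CommEquiv M (p ++ a :: q) (a :: (p ++ q)) := by
  induction p with
  | nil => exact CommEquiv.refl _
  | cons c p ih =>
    have h := (ih fun c hc => hp c (by simp [hc])).append_left [c]
    refine h.trans (CommEquiv.swap ?_ [] (p ++ q))
    rw [M.symmetric]
    exact hp c (by simp)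

/-- Follow the initial occurrence of `a` along the commutation steps: whatever has come to stand
before it has passed it, hence commutes with it. Each step lies before this occurrence, lies after
it, or moves it by one place. -/
theorem CommEquiv.exists_of_cons {a : B} {y z : List B} (h : CommEquiv M (a :: y) z) :
    ∃ p q, z = p ++ a :: q ∧ (∀ c ∈ p, M a c = 2) ∧ CommEquiv M y (p ++ q) := by
  induction h with
  | refl => exact ⟨[], y, rfl, by simp, CommEquiv.refl _⟩
  | tail _ h ih =>
    obtain ⟨p, q, rfl, hp, hy⟩ := ih
    obtain ⟨u, v, s, t, hst, he, rfl⟩ := h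
    rw [List.append_eq_append_iff] at he
    obtain ⟨r, hu, hq⟩ | ⟨r, hu, hq⟩ := he
    · rcases r with _ | ⟨b, r⟩
      · simp only [List.nil_append, List.cons.injEq, List.append_nil] at hq hu
        obtain ⟨rfl, rfl⟩ := hq
        subst hu
        refine ⟨u ++ [t], v, by simp, ?_, by simpa using hy⟩
        simpa [or_imp, forall_and, hst] using hp
      · simp only [List.cons_append, List.cons.injEq] at hq
        obtain ⟨rfl, rfl⟩ := hq
        subst hu
        refine ⟨p, r ++ t :: s :: v, by simp, hp, hy.trans ?_⟩
        simpa using CommEquiv.swap hst (p ++ r) v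
    · rcases r with _ | ⟨b, r⟩
      · simp only [List.nil_append, List.cons.injEq, List.append_nil] at hq hu
        obtain ⟨rfl, rfl⟩ := hq
        subst hu
        refine ⟨p ++ [t], v, by simp, ?_, by simpa using hy⟩
        simpa [or_imp, forall_and, hst] using hp
      · simp only [List.cons_append, List.cons.injEq] at hq
        obtain ⟨rfl, hq⟩ := hq
        rcases r with _ | ⟨b, r⟩
        · simp only [List.nil_append, List.cons.injEq] at hq
          obtain ⟨rfl, rfl⟩ := hq
          subst hu
          refine ⟨u, s :: v, by simp, fun c hc => hp c (by simp [hc]), by simpa using hy⟩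
        · simp only [List.cons_append, List.cons.injEq] at hq
          obtain ⟨rfl, rfl⟩ := hq
          subst hu
          refine ⟨u ++ t :: s :: r, q, by simp, ?_, hy.trans ?_⟩
          · intro c hc
            apply hp c
            simp only [List.mem_append, List.mem_cons] at hc ⊢
            tauto
          · simpa using CommEquiv.swap hst u (r ++ q)

/-! ### Regularity of commutation-closed languages. -/

/-- A set of words that is a union of commutation classes. -/
def CommClosed (M : CoxeterMatrix B) (K : Set (List B)) : Prop :=
  ∀ ⦃ω ω'⦄, CommEquiv M ω ω' → ω ∈ K → ω' ∈ K

/-- The words commutation equivalent to a word of `K₁` followed by a word of `K₂`. -/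
def commConcat (M : CoxeterMatrix B) (K₁ K₂ : Set (List B)) : Set (List B) :=
  {ω | ∃ x ∈ K₁, ∃ y ∈ K₂, CommEquiv M ω (x ++ y)}

theorem commClosed_commConcat (K₁ K₂ : Set (List B)) : CommClosed M (commConcat M K₁ K₂) := by
  rintro ω ω' h ⟨x, hx, y, hy, hxy⟩
  exact ⟨x, hx, y, hy, h.symm.trans hxy⟩

theorem commClosed_univ : CommClosed M (Set.univ : Set (List B)) := fun _ _ _ _ => trivial

theorem CommClosed.quotient {K : Set (List B)} (hK : CommClosed M K) (x : List B) :
    CommClosed M {y | x ++ y ∈ K} := fun _ _ h hy => hK (h.append_left x) hy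

theorem CommClosed.quotientFiber {K : Set (List B)} (hK : CommClosed M K) (q : Set (List B)) :
    CommClosed M {v | {y | v ++ y ∈ K} = q} := by
  rintro v v' h rfl
  ext y
  exact ⟨hK (h.symm.append_right y), hK (h.append_right y)⟩

theorem commClosed_commClass (b : List B) : CommClosed M {ω | CommEquiv M ω b} :=
  fun _ _ h h' => h.symm.trans h'

variable [Finite B]

theorem hasFiniteQuotients_commConcat {K₁ K₂ : Set (List B)} (h₁ : CommClosed M K₁)
    (hK₁ : HasFiniteQuotients K₁) (h₂ : CommClosed M K₂) (hK₂ : HasFiniteQuotients K₂) :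
    HasFiniteQuotients (commConcat M K₁ K₂) := by
  -- States of a nondeterministic automaton that guesses, for each letter read, which of the two
  -- factors it comes from. `L₁` and `L₂` are what remains of the factors; `X` holds the letters
  -- still allowed in the first one, namely those commuting with every letter already taken from the
  -- second.
  let F : Set (List B) → Set B → Set (List B) → Set (List B) := fun L₁ X L₂ =>
    commConcat M (L₁ ∩ {x | ∀ c ∈ x, c ∈ X}) L₂
  let 𝓕 : Set (Set (List B)) :=
    (fun p : Set (List B) × Set B × Set (List B) => F p.1 p.2.1 p.2.2) ''
      ((Set.range fun x : List B => {y | x ++ y ∈ K₁}) ×ˢ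
        (Set.univ ×ˢ (Set.range fun x : List B => {y | x ++ y ∈ K₂})))
  have h𝓕 : 𝓕.Finite := (hK₁.prod (Set.finite_univ.prod hK₂)).image _
  refine HasFiniteQuotients.of_family h𝓕 ?_
    ⟨(K₁, Set.univ, K₂), ⟨⟨[], rfl⟩, trivial, ⟨[], rfl⟩⟩, by simp [F]⟩
  rintro _ ⟨⟨_, X, _⟩, ⟨⟨w₁, rfl⟩, -, ⟨w₂, rfl⟩⟩, rfl⟩ a y ⟨x₁, ⟨hx₁, hX⟩, x₂, hx₂, hy⟩
  simp only [Set.mem_ofPred_eq] at hx₁ hX hx₂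
  obtain ⟨p, q, he, hp, hpq⟩ := hy.exists_of_cons
  have hcase : (∃ q', x₁ = p ++ a :: q' ∧ q = q' ++ x₂) ∨
      ∃ p', p = x₁ ++ p' ∧ x₂ = p' ++ a :: q := by
    rw [List.append_eq_append_iff] at he
    obtain ⟨r, h, h'⟩ | ⟨r, h, h'⟩ := he
    · exact .inr ⟨r, h, h'⟩
    · rcases r with _ | ⟨b, r⟩
      · exact .inr ⟨[], by simpa using h.symm, by simpa using h'.symm⟩
      · simp only [List.cons_append, List.cons.injEq] at h'
        obtain ⟨rfl, rfl⟩ := h'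
        exact .inl ⟨r, h, rfl⟩
  obtain ⟨q', rfl, rfl⟩ | ⟨p', rfl, rfl⟩ := hcase
  -- The letter comes from the first factor, where closure of `K₁` brings it to the front.
  · refine ⟨_, ⟨(_, X, _), ⟨⟨w₁ ++ [a], rfl⟩, trivial, ⟨w₂, rfl⟩⟩, rfl⟩, ?_, ?_⟩
    · refine ⟨p ++ q', ⟨?_, ?_⟩, x₂, hx₂, by simpa using hpq⟩
      · have := h₁ ((CommEquiv.append_cons hp q').append_left w₁) hx₁
        change w₁ ++ [a] ++ (p ++ q') ∈ K₁
        simpa using this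
      · intro c hc
        apply hX
        simp only [List.mem_append, List.mem_cons] at hc ⊢
        tauto
    · rintro z ⟨z₁, ⟨hz₁, hzX⟩, z₂, hz₂, hz⟩
      have hz₁ : w₁ ++ [a] ++ z₁ ∈ K₁ := hz₁
      refine ⟨a :: z₁, ⟨by simpa using hz₁, ?_⟩, z₂, hz₂, by simpa using hz.append_left [a]⟩
      have ha : a ∈ X := hX a (by simp)
      simpa [ha] using hzX
  -- The letter comes from the second factor, so it has passed all of `x₁`; this shrinks `X`.
  · refine ⟨_, ⟨(_, X ∩ {c | M a c = 2}, _), ⟨⟨w₁, rfl⟩, trivial, ⟨w₂ ++ [a], rfl⟩⟩, rfl⟩, ?_, ?_⟩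
    · refine ⟨x₁, ⟨hx₁, fun c hc => ⟨hX c hc, hp c (by simp [hc])⟩⟩, p' ++ q, ?_, by simpa using hpq⟩
      have := h₂ ((CommEquiv.append_cons (fun c hc => hp c (by simp [hc])) q).append_left w₂) hx₂
      change w₂ ++ [a] ++ (p' ++ q) ∈ K₂
      simpa using this
    · rintro z ⟨z₁, ⟨hz₁, hzX⟩, z₂, hz₂, hz⟩
      have hz₂ : w₂ ++ [a] ++ z₂ ∈ K₂ := hz₂
      refine ⟨z₁, ⟨hz₁, fun c hc => (hzX c hc).1⟩, a :: z₂, by simpa using hz₂, ?_⟩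
      refine (hz.append_left [a]).trans ?_
      exact (CommEquiv.append_cons (fun c hc => (hzX c hc).2) z₂).symm

/-- The words that become a member of `G` after commutations and one rotation have finitely many
quotients if `G` has. -/
theorem hasFiniteQuotients_rotation {G : Set (List B)} (hG : CommClosed M G)
    (hfin : HasFiniteQuotients G) :
    HasFiniteQuotients {ω | ∃ u v, CommEquiv M ω (u ++ v) ∧ v ++ u ∈ G} := by
  have : Finite (Set.range fun x : List B => {y | x ++ y ∈ G}) := hfin
  -- Sort the pairs by the quotient `q` of `G` by `v`; the condition on `u` becomes `u ∈ q`, which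
  -- separates the two factors.
  have heq : {ω | ∃ u v, CommEquiv M ω (u ++ v) ∧ v ++ u ∈ G} =
      ⋃ q : Set.range fun x : List B => {y | x ++ y ∈ G},
        commConcat M q.1 {v | {y | v ++ y ∈ G} = q.1} := by
    ext ω
    simp only [Set.mem_iUnion]
    constructor
    · rintro ⟨u, v, h, hvu⟩
      exact ⟨⟨_, v, rfl⟩, u, hvu, v, rfl, h⟩
    · rintro ⟨q, u, hu, v, hv, h⟩
      rw [← (show _ = q.1 from hv)] at hu
      exact ⟨u, v, h, hu⟩
  rw [heq]
  refine HasFiniteQuotients.iUnion ?_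
  rintro ⟨_, x, rfl⟩
  exact hasFiniteQuotients_commConcat (hG.quotient x) (hfin.quotient x)
    (hG.quotientFiber _) (hfin.quotientFiber _)

theorem finite_commClass (b : List B) : {ω | CommEquiv M ω b}.Finite :=
  (List.finite_length_eq B b.length).subset fun _ h => h.length_eq

/-- The words some commutation equivalent of which has a factor in `S`. -/
def commFactorSet (M : CoxeterMatrix B) (S : Set (List B)) : Set (List B) :=
  {ω | ∃ b ∈ S, ∃ x y, CommEquiv M ω (x ++ b ++ y)}

omit [Finite B] in
theorem commClosed_commFactorSet (S : Set (List B)) : CommClosed M (commFactorSet M S) := by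
  rintro ω ω' h ⟨b, hb, x, y, hxy⟩
  exact ⟨b, hb, x, y, h.symm.trans hxy⟩

theorem hasFiniteQuotients_commFactorSet {S : Set (List B)} (hS : S.Finite) :
    HasFiniteQuotients (commFactorSet M S) := by
  have : Finite S := hS
  have heq : commFactorSet M S =
      ⋃ b : S, commConcat M Set.univ (commConcat M {ω | CommEquiv M ω b.1} Set.univ) := by
    ext ω
    simp only [Set.mem_iUnion]
    constructor
    · rintro ⟨b, hb, x, y, h⟩
      refine ⟨⟨b, hb⟩, x, trivial, b ++ y, ?_, by simpa using h⟩
      exact ⟨b, CommEquiv.refl _, y, trivial, CommEquiv.refl _⟩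
    · rintro ⟨b, x, -, z, ⟨b', hb', y, -, hz⟩, h⟩
      refine ⟨b.1, b.2, x, y, ?_⟩
      rw [List.append_assoc]
      exact h.trans ((hz.trans (CommEquiv.append_right y hb')).append_left x)
  rw [heq]
  exact HasFiniteQuotients.iUnion fun b => hasFiniteQuotients_commConcat commClosed_univ .univ
    (commClosed_commConcat _ _) (hasFiniteQuotients_commConcat (commClosed_commClass _)
      (.of_finite (finite_commClass b.1)) commClosed_univ .univ)

end CoxeterSystem

/-! ### Rationality by the transfer-matrix method. -/

section GeneratingSeries

variable {α : Type*} [Finite α]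

theorem finite_wordsOfLength (K : Set (List α)) (n : ℕ) : {ω ∈ K | ω.length = n}.Finite :=
  (List.finite_length_eq α n).subset fun _ h => h.2

open Classical in
omit [Finite α] in
theorem coeff_zero_wordGeneratingSeries (K : Set (List α)) :
    PowerSeries.coeff 0 (wordGeneratingSeries K) = if [] ∈ K then 1 else 0 := by
  rw [wordGeneratingSeries, PowerSeries.coeff_mk]
  split_ifs with h
  · have : {ω ∈ K | ω.length = 0} = {[]} := by
      ext ω
      simp only [Set.mem_ofPred_eq, List.length_eq_zero_iff, Set.mem_singleton_iff]
      exact ⟨fun h => h.2, fun h' => ⟨h' ▸ h, h'⟩⟩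
    rw [this]
    simp
  · have : {ω ∈ K | ω.length = 0} = ∅ := by
      ext ω
      simp only [Set.mem_ofPred_eq, List.length_eq_zero_iff, Set.mem_empty_iff_false, iff_false]
      rintro ⟨h', rfl⟩
      exact h h'
    rw [this]
    simp

/-- Splitting off the first letter of the words of length `n + 1`. -/
def wordsOfLengthSuccEquiv (K : Set (List α)) (n : ℕ) :
    ({ω ∈ K | ω.length = n + 1} : Set (List α)) ≃
      Σ a : α, ({ω ∈ {y | a :: y ∈ K} | ω.length = n} : Set (List α)) where
  toFun
    | ⟨a :: y, h⟩ => ⟨a, y, h.1, by simpa using h.2⟩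
  invFun p := ⟨p.1 :: p.2.1, p.2.2.1, by simpa using p.2.2.2⟩
  left_inv
    | ⟨a :: y, h⟩ => rfl
  right_inv _ := rfl

theorem coeff_succ_wordGeneratingSeries [Fintype α] (K : Set (List α)) (n : ℕ) :
    PowerSeries.coeff (n + 1) (wordGeneratingSeries K) =
      ∑ a : α, PowerSeries.coeff n (wordGeneratingSeries {y | a :: y ∈ K}) := by
  simp only [wordGeneratingSeries, PowerSeries.coeff_mk]
  have (a : α) : Finite ({ω ∈ {y | a :: y ∈ K} | ω.length = n} : Set (List α)) :=
    finite_wordsOfLength _ n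
  rw [← Nat.card_coe_set_eq, Nat.card_congr (wordsOfLengthSuccEquiv K n), Nat.card_sigma]
  push_cast
  rfl

-- Splitting off the first letter gives a linear system `(1 - A) F = ε` for the series of the
-- quotients, where `A` is `X` times the transition matrix. The adjugate solves it with denominator
-- `det (1 - A)`, whose constant term is `1` because `A` vanishes at `X = 0`.
open Classical in
theorem HasFiniteQuotients.isRationalSeries {K : Set (List α)} (hK : HasFiniteQuotients K) :
    (wordGeneratingSeries K).IsRationalSeries := by
  have := Fintype.ofFinite α
  let ι := Set.range fun x : List α => {y | x ++ y ∈ K}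
  have : Fintype ι := hK.fintype
  let δ : ι → α → ι := fun q a => ⟨{y | a :: y ∈ q.1}, by
    obtain ⟨_, x, rfl⟩ := q
    exact ⟨x ++ [a], by simp⟩⟩
  let A : Matrix ι ι (Polynomial ℚ) :=
    .of fun q q' => ∑ a : α, if δ q a = q' then Polynomial.X else 0
  let ε : ι → Polynomial ℚ := fun q => if [] ∈ q.1 then 1 else 0
  let φ : Polynomial ℚ →+* PowerSeries ℚ := Polynomial.coeToPowerSeries.ringHom
  let F : ι → PowerSeries ℚ := fun q => wordGeneratingSeries q.1
  have hF (q : ι) : F q = φ (ε q) + ∑ a : α, PowerSeries.X * F (δ q a) := by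
    ext n
    rw [map_add, map_sum]
    cases n with
    | zero =>
      simp only [F, coeff_zero_wordGeneratingSeries]
      simp only [PowerSeries.coeff_zero_X_mul, Finset.sum_const_zero, add_zero, φ, ε]
      split_ifs <;> simp
    | succ n =>
      simp only [F, coeff_succ_wordGeneratingSeries, PowerSeries.coeff_succ_X_mul]
      have : PowerSeries.coeff (n + 1) (φ (ε q)) = 0 := by
        simp only [φ, ε]
        split_ifs <;> simp [PowerSeries.coeff_one]
      rw [this, zero_add]
  have hsys : (φ.mapMatrix (1 - A)).mulVec F = φ ∘ ε := by
    funext q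
    have : (φ.mapMatrix A).mulVec F q = ∑ a : α, PowerSeries.X * F (δ q a) := by
      simp only [Matrix.mulVec, dotProduct, RingHom.mapMatrix_apply, Matrix.map_apply, A, Matrix.of_apply, map_sum,
        Finset.sum_mul]
      rw [Finset.sum_comm]
      refine Finset.sum_congr rfl fun a _ => ?_
      rw [Finset.sum_eq_single (δ q a)]
      · simp [φ]
      · intro q' _ h
        simp [h.symm]
      · simp
    rw [map_sub, map_one, Matrix.sub_mulVec, Matrix.one_mulVec, Pi.sub_apply, this, hF q]
    simp
  let q₀ : ι := ⟨K, [], rfl⟩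
  refine ⟨((1 - A).adjugate.mulVec ε) q₀, (1 - A).det, ?_, ?_⟩
  · rw [Polynomial.coeff_zero_eq_eval_zero, ← Polynomial.coe_evalRingHom, RingHom.map_det]
    have : (Polynomial.evalRingHom (0 : ℚ)).mapMatrix (1 - A) = 1 := by
      rw [map_sub, map_one, sub_eq_self]
      ext q q'
      simp only [RingHom.mapMatrix_apply, Matrix.map_apply, A, Matrix.of_apply, map_sum, Matrix.zero_apply]
      refine Finset.sum_eq_zero fun a _ => ?_
      split_ifs <;> simp
    rw [this, Matrix.det_one]
    exact one_ne_zero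
  · have h := congrArg (fun v => ((φ.mapMatrix (1 - A)).adjugate.mulVec v) q₀) hsys
    simp only [Matrix.mulVec_mulVec, Matrix.adjugate_mul, Matrix.smul_mulVec, Matrix.one_mulVec] at h
    rw [← RingHom.map_det, ← RingHom.map_adjugate] at h
    have h2 : ((φ.mapMatrix (1 - A).adjugate).mulVec (φ ∘ ε)) q₀ =
        φ (((1 - A).adjugate.mulVec ε) q₀) := by
      rw [RingHom.map_mulVec]
      rfl
    rw [h2] at h
    exact h

end GeneratingSeries

/-! ### The geometric representation and the order of `s_i s_j`. -/

open Polynomial.Chebyshev in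
/-- A bracket of Chebyshev values that vanishes at `2 cos (2π / m)`. -/
theorem chebyshevS_eval_mul_add_eq_zero {m : ℕ} (hm : 3 ≤ m) (t : ℝ)
    (ht : t = 2 * Real.cos (2 * Real.pi / m)) :
    ((S ℝ (((m : ℤ) - 2) / 2)).eval t *
        ((S ℝ (((m : ℤ) - 1) / 2)).eval t + (S ℝ (((m : ℤ) - 3) / 2)).eval t) = 0) ∧
      ((S ℝ (((m : ℤ) - 1) / 2)).eval t *
        ((S ℝ ((m : ℤ) / 2)).eval t + (S ℝ (((m : ℤ) - 2) / 2)).eval t) = 0) := by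
  have hm0 : (0 : ℝ) < m := by positivity
  have hm3 : (3 : ℝ) ≤ m := by exact_mod_cast hm
  have hsin : Real.sin (2 * Real.pi / m) ≠ 0 := by
    refine (Real.sin_pos_of_pos_of_lt_pi (by positivity) ?_).ne'
    rw [div_lt_iff₀ hm0]
    nlinarith [Real.pi_pos]
  have hS (n : ℤ) := S_two_mul_real_cos (2 * Real.pi / m) n
  rw [← ht] at hS
  -- With `θ = 2π/m`, `S_n(t) sin θ = sin ((n+1)θ)`. For `m = 2k` the factor `S_{k-1}` vanishes
  -- since `kθ = π`; for `m = 2k+1` the sum `S_k + S_{k-1}` vanishes since `(k+1)θ = 2π - kθ`.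
  obtain ⟨k, rfl | rfl⟩ : ∃ k, m = 2 * k ∨ m = 2 * k + 1 := ⟨m / 2, by lia⟩
  · have h1 : (((2 * k : ℕ) : ℤ) - 2) / 2 = k - 1 := by lia
    have h2 : (((2 * k : ℕ) : ℤ) - 1) / 2 = k - 1 := by lia
    have hz : (S ℝ ((k : ℤ) - 1)).eval t = 0 := by
      have h := hS (k - 1)
      have h' : (((k : ℤ) - 1 : ℤ) + 1 : ℝ) * (2 * Real.pi / (2 * k : ℕ)) = Real.pi := by
        have hk : (k : ℝ) ≠ 0 := fun hk => by simp [hk] at hm0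
        push_cast
        field_simp
        ring
      rw [h', Real.sin_pi] at h
      exact (mul_eq_zero.1 h).resolve_right hsin
    rw [h1, h2, hz]
    simp
  · have h1 : (((2 * k + 1 : ℕ) : ℤ) - 2) / 2 = k - 1 := by lia
    have h2 : (((2 * k + 1 : ℕ) : ℤ) - 1) / 2 = k := by lia
    have h3 : (((2 * k + 1 : ℕ) : ℤ) - 3) / 2 = k - 1 := by lia
    have h4 : (((2 * k + 1 : ℕ) : ℤ)) / 2 = k := by lia
    have hz : (S ℝ (k : ℤ)).eval t + (S ℝ ((k : ℤ) - 1)).eval t = 0 := by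
      have h := hS (k - 1)
      have h' := hS k
      have e : (((k : ℤ) : ℝ) + 1) * (2 * Real.pi / (2 * k + 1 : ℕ)) =
          2 * Real.pi - (((k : ℤ) - 1 : ℤ) + 1 : ℝ) * (2 * Real.pi / (2 * k + 1 : ℕ)) := by
        push_cast at hm0 ⊢
        field_simp
        ring
      rw [e, Real.sin_two_pi_sub, ← h] at h'
      have : ((S ℝ (k : ℤ)).eval t + (S ℝ ((k : ℤ) - 1)).eval t) *
          Real.sin (2 * Real.pi / (2 * k + 1 : ℕ)) = 0 := by linarith
      exact (mul_eq_zero.1 this).resolve_right hsin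
    rw [h1, h2, h3, h4, hz]
    simp

namespace CoxeterMatrix

variable {B : Type*} (M : CoxeterMatrix B)

/-- The coroot of index `i` of the geometric representation, a linear form on `B →₀ ℝ`. -/
noncomputable def geomCoroot (i : B) : Module.Dual ℝ (B →₀ ℝ) :=
  Finsupp.linearCombination ℝ fun j => -2 * Real.cos (Real.pi / M i j)

theorem geomCoroot_single (i j : B) :
    M.geomCoroot i (Finsupp.single j 1) = -2 * Real.cos (Real.pi / M i j) := by
  simp [geomCoroot]

theorem geomCoroot_single_self (i : B) : M.geomCoroot i (Finsupp.single i 1) = 2 := by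
  simp [geomCoroot_single]

/-- The reflection of index `i` of the geometric representation. -/
noncomputable def geomReflection (i : B) : (B →₀ ℝ) ≃ₗ[ℝ] (B →₀ ℝ) :=
  Module.reflection (M.geomCoroot_single_self i)

theorem geomCoroot_mul_geomCoroot (i j : B) :
    M.geomCoroot i (Finsupp.single j 1) * M.geomCoroot j (Finsupp.single i 1) - 2 =
      2 * Real.cos (2 * Real.pi / M i j) := by
  rw [geomCoroot_single, geomCoroot_single, M.symmetric j i, mul_div_assoc, Real.cos_two_mul]
  ring

theorem isLiftable_geomReflection : M.IsLiftable M.geomReflection := by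
  intro i j
  obtain rfl | hij := eq_or_ne i j
  · rw [M.diagonal, pow_one]
    ext1 z
    exact Module.involutive_reflection (M.geomCoroot_single_self i) z
  have h1 := M.off_diagonal i j hij
  obtain h0 | h2 | h3 : M i j = 0 ∨ M i j = 2 ∨ 3 ≤ M i j := by
    have : M i j ≠ 1 := h1
    lia
  · rw [h0, pow_zero]
  -- For `m = 2` the angle `2π/m` is `π`, where the sine argument fails; here the reflections simply
  -- commute.
  · have hi : M.geomCoroot i (Finsupp.single j 1) = 0 := by simp [geomCoroot_single, h2]
    have hj : M.geomCoroot j (Finsupp.single i 1) = 0 := by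
      simp [geomCoroot_single, M.symmetric j i, h2]
    rw [h2]
    ext1 z
    have hc (z) : M.geomReflection i (M.geomReflection j z) =
        M.geomReflection j (M.geomReflection i z) := by
      simp only [geomReflection, Module.reflection_apply, map_sub, map_smul, hi, hj]
      module
    have hinv (k z) : M.geomReflection k (M.geomReflection k z) = z :=
      Module.involutive_reflection (M.geomCoroot_single_self k) z
    change M.geomReflection i (M.geomReflection j (M.geomReflection i (M.geomReflection j z))) = z
    rw [← hc (M.geomReflection j z), hinv, hinv]
  · ext1 z
    have h := Module.reflection_mul_reflection_pow_apply (M.geomCoroot_single_self i)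
      (M.geomCoroot_single_self j) (M i j) z
    obtain ⟨e1, e2⟩ := chebyshevS_eval_mul_add_eq_zero h3 _ (M.geomCoroot_mul_geomCoroot i j)
    rw [e1, e2, zero_smul, zero_smul, add_zero, add_zero] at h
    exact h

-- Compare coordinates of the image of the `i`-th basis vector under the `k`-th power. The `i`-th
-- one gives `S_k(t) + S_{k-1}(t) = 1`; the `j`-th one gives `S_{k-1}(t) = 0` unless `cos (π/m) =
-- 0`, that is, `m = 2`.
open Polynomial.Chebyshev in
theorem dvd_of_geomReflection_pow_eq_one {i j : B} (hij : i ≠ j) {k : ℕ}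
    (h : (M.geomReflection i * M.geomReflection j) ^ k = 1) : M i j ∣ k := by
  set t := M.geomCoroot i (Finsupp.single j 1) * M.geomCoroot j (Finsupp.single i 1) - 2 with ht
  have hx := Module.reflection_mul_reflection_pow_apply_self (M.geomCoroot_single_self i)
    (M.geomCoroot_single_self j) k t ht
  change ((M.geomReflection i * M.geomReflection j) ^ k) _ = _ at hx
  rw [h] at hx
  have hxi := DFunLike.congr_fun hx i
  have hxj := DFunLike.congr_fun hx j
  simp [hij, hij.symm] at hxi hxj
  have hji := M.geomCoroot_single j i
  rw [M.symmetric j i] at hji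
  rw [hji] at hxj
  have htc := M.geomCoroot_mul_geomCoroot i j
  rw [← ht] at htc
  have h1 : M i j ≠ 1 := M.off_diagonal i j hij
  obtain h0 | h2 | h3 : M i j = 0 ∨ M i j = 2 ∨ 3 ≤ M i j := by lia
  -- `m = 0` encodes infinite order. As `π / 0 = 0`, the parameter `t` is `2`, and `S_{k-1}(2) = k`
  -- forces `k = 0`.
  · simp only [h0, Nat.cast_zero, div_zero, Real.cos_zero, mul_one] at htc
    rw [htc, S_eval_two] at hxj
    simpa [h0] using hxj
  · rw [h2]
    simp only [h2, Nat.cast_ofNat] at htc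
    rw [mul_div_cancel_left₀ _ (two_ne_zero), Real.cos_pi] at htc
    rw [show t = -2 by linarith, S_eval_neg_two, S_eval_neg_two] at hxi
    obtain hk | hk := Nat.even_or_odd k
    · exact hk.two_dvd
    · exfalso
      have hk' : Odd (k : ℤ) := by exact_mod_cast hk
      rw [Int.negOnePow_odd _ hk', Int.negOnePow_even _ (hk'.sub_odd odd_one)] at hxi
      push_cast at hxi
      simp at hxi
      linarith
  · have hm3 : (3 : ℝ) ≤ M i j := by exact_mod_cast h3
    have hm0 : (0 : ℝ) < M i j := by linarith
    have hpi := Real.pi_pos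
    have hcos : Real.cos (Real.pi / M i j) ≠ 0 := by
      refine (Real.cos_pos_of_mem_Ioo ⟨?_, ?_⟩).ne'
      · have : 0 < Real.pi / M i j := by positivity
        linarith
      · rw [div_lt_iff₀ hm0]
        nlinarith
    have hS (n : ℤ) := S_two_mul_real_cos (2 * Real.pi / M i j) n
    rw [← htc] at hS
    have hz : (S ℝ ((k : ℤ) - 1)).eval t = 0 := by
      rcases hxj with h | h
      · exact h
      · exact absurd (by linarith) hcos
    have hone : (S ℝ (k : ℤ)).eval t = 1 := by linarith
    have e1 := hS (k - 1)
    have e2 := hS k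
    rw [hz, zero_mul] at e1
    rw [hone, one_mul] at e2
    have hsin : Real.sin (2 * Real.pi / M i j) ≠ 0 := by
      refine (Real.sin_pos_of_pos_of_lt_pi (by positivity) ?_).ne'
      rw [div_lt_iff₀ hm0]
      nlinarith
    push_cast at e1 e2
    rw [sub_add_cancel] at e1
    rw [add_mul, one_mul, Real.sin_add, ← e1, zero_mul, zero_add] at e2
    have hc : Real.cos (k * (2 * Real.pi / M i j)) = 1 := by
      have := sub_eq_zero.2 e2
      have h' : (1 - Real.cos (k * (2 * Real.pi / M i j))) * Real.sin (2 * Real.pi / M i j) = 0 := by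
        linarith
      have := (mul_eq_zero.1 h').resolve_right hsin
      linarith
    obtain ⟨n, hn⟩ := (Real.cos_eq_one_iff _).1 hc
    have : (n : ℝ) * M i j = k := by
      field_simp at hn
      linarith
    exact Int.natCast_dvd_natCast.1 ⟨n, by rw [mul_comm]; exact_mod_cast this.symm⟩

end CoxeterMatrix

/-! ### The exchange property through a signed conjugation action. -/

namespace CoxeterSystem

variable {B W : Type*} [Group W] {M : CoxeterMatrix B} (cs : CoxeterSystem M W)

theorem dvd_of_simple_mul_simple_pow_eq_one {i j : B} (hij : i ≠ j) {k : ℕ}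
    (h : (cs.simple i * cs.simple j) ^ k = 1) : M i j ∣ k := by
  refine M.dvd_of_geomReflection_pow_eq_one hij ?_
  have := congrArg (cs.lift ⟨_, M.isLiftable_geomReflection⟩) h
  simpa only [map_pow, map_mul, lift_apply_simple, map_one] using this

open Classical in
/-- The permutation by which the simple reflection of index `i` acts on signed elements of `W`. -/
noncomputable def signedConj (i : B) : Function.End (W × ZMod 2) := fun p =>
  (cs.simple i * p.1 * cs.simple i, p.2 + if p.1 = cs.simple i then 1 else 0)

open Classical in
theorem signedConj_mul_signedConj_pow_apply (i j : B) (n : ℕ) (t : W) (ε : ZMod 2) :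
    ((cs.signedConj i * cs.signedConj j) ^ n) (t, ε) =
      ((cs.simple i * cs.simple j) ^ n * t * ((cs.simple i * cs.simple j) ^ n)⁻¹,
        ε + ∑ l ∈ Finset.range (2 * n),
          if (cs.simple i * cs.simple j) ^ l * t = cs.simple j then 1 else 0) := by
  have hi := cs.simple_mul_simple_self i
  have hj := cs.simple_mul_simple_self j
  have hc : ∀ n, ((cs.simple i * cs.simple j) ^ n)⁻¹ * cs.simple j =
      cs.simple j * (cs.simple i * cs.simple j) ^ n := by
    intro n
    rw [← inv_pow]
    exact ((SemiconjBy.pow_right (a := cs.simple j) (x := cs.simple i * cs.simple j)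
      (y := (cs.simple i * cs.simple j)⁻¹) (by simp [SemiconjBy, mul_assoc]) n).eq).symm
  induction n with
  | zero => simp; rfl
  | succ n ih =>
    rw [pow_succ']
    change cs.signedConj i (cs.signedConj j (((cs.signedConj i * cs.signedConj j) ^ n) (t, ε))) = _
    rw [ih]
    set c := cs.simple i * cs.simple j with hcdef
    refine Prod.ext ?_ ?_
    · simp [signedConj, pow_succ', hcdef, mul_assoc]
    · have e1 : c ^ n * t * (c ^ n)⁻¹ = cs.simple j ↔ c ^ (2 * n) * t = cs.simple j := by
        rw [mul_inv_eq_iff_eq_mul, ← hc, eq_inv_mul_iff_mul_eq, ← mul_assoc, ← pow_add, two_mul]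
      have e2 : cs.simple j * (c ^ n * t * (c ^ n)⁻¹) * cs.simple j = cs.simple i ↔
          c ^ (2 * n + 1) * t = cs.simple j := by
        have hX (X : W) : cs.simple j * X * cs.simple j = cs.simple i ↔
            X = c⁻¹ * cs.simple j := by
          constructor
          · intro h
            rw [show X = cs.simple j * (cs.simple j * X * cs.simple j) * cs.simple j by
              simp [mul_assoc], h]
            simp [hcdef]
          · rintro rfl
            simp [hcdef, mul_assoc]
        rw [hX, mul_inv_eq_iff_eq_mul, mul_assoc, ← hc, eq_inv_mul_iff_mul_eq,
          eq_inv_mul_iff_mul_eq, ← mul_assoc, ← mul_assoc, ← pow_succ, ← pow_add,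
          show n + 1 + n = 2 * n + 1 by lia]
      simp only [signedConj, mul_add, Finset.sum_range_succ, mul_one, e1, e2]
      ring_nf

/-- After `m` rounds the sign has collected `2m` terms of period `m`, so they cancel in pairs modulo
`2`. -/
theorem isLiftable_signedConj : M.IsLiftable cs.signedConj := by
  classical
  intro i j
  funext ⟨t, ε⟩
  rw [signedConj_mul_signedConj_pow_apply, simple_mul_simple_pow, two_mul, Finset.sum_range_add]
  simp only [pow_add, simple_mul_simple_pow, one_mul, inv_one, mul_one, CharTwo.add_self_eq_zero,
    add_zero]
  rfl

-- Since the left side depends only on the group element, so does the parity of the multiplicity of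
-- `t` in the inversion sequence.
open Classical in
theorem lift_signedConj_wordProd (ω : List B) (t : W) (ε : ZMod 2) :
    cs.lift ⟨_, cs.isLiftable_signedConj⟩ (cs.wordProd ω) (t, ε) =
      (cs.wordProd ω * t * (cs.wordProd ω)⁻¹, ε + (cs.rightInvSeq ω).count t) := by
  induction ω with
  | nil => simp; rfl
  | cons i ω ih =>
    rw [wordProd_cons, map_mul, lift_apply_simple]
    change cs.signedConj i (cs.lift ⟨_, cs.isLiftable_signedConj⟩ (cs.wordProd ω) (t, ε)) = _
    rw [ih]
    refine Prod.ext (by simp [signedConj, mul_assoc]) ?_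
    have : cs.wordProd ω * t * (cs.wordProd ω)⁻¹ = cs.simple i ↔
        ((cs.wordProd ω)⁻¹ * cs.simple i * cs.wordProd ω) = t := by
      rw [mul_inv_eq_iff_eq_mul, mul_assoc, inv_mul_eq_iff_eq_mul, eq_comm]
    simp only [signedConj, rightInvSeq, List.count_cons, beq_iff_eq, this]
    split_ifs <;> push_cast <;> ring

variable {cs} in
/-- The exchange property. -/
theorem IsRightDescent.simple_mem_rightInvSeq {w : W} {i : B} (h : cs.IsRightDescent w i) {ω : List B}
    (hω : cs.wordProd ω = w) : cs.simple i ∈ cs.rightInvSeq ω := by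
  classical
  -- A reduced word of `w` ending in `i` contains `s_i` exactly once in its inversion sequence; by
  -- parity the sequence of `ω` contains it too.
  obtain ⟨μ, hμ, hμw⟩ := cs.exists_isReduced (w * cs.simple i)
  have hw : cs.wordProd (μ.concat i) = w := by rw [wordProd_concat, ← hμw]; simp
  have hred : cs.IsReduced (μ.concat i) := by
    rw [IsReduced, hw, List.length_concat, ← hμ.eq, ← hμw]
    exact (cs.isRightDescent_iff.1 h).symm
  have hmem : cs.simple i ∈ cs.rightInvSeq (μ.concat i) := by
    rw [rightInvSeq_concat]
    simp
  have e1 := cs.lift_signedConj_wordProd (μ.concat i) (cs.simple i) 0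
  have e2 := cs.lift_signedConj_wordProd ω (cs.simple i) 0
  rw [hw] at e1
  rw [hω, e1, List.count_eq_one_of_mem hred.nodup_rightInvSeq hmem] at e2
  have := congrArg Prod.snd e2
  by_contra hn
  rw [List.count_eq_zero_of_not_mem hn] at this
  simp at this

end CoxeterSystem

/-! ### Two right descents force a braid word. -/

namespace CoxeterSystem

variable {B W : Type*} [Group W] {M : CoxeterMatrix B} (cs : CoxeterSystem M W)

theorem exists_pow_mul_of_mem_rightInvSeq_alternatingWord {i j : B} {k : ℕ} {t : W}
    (ht : t ∈ cs.rightInvSeq (alternatingWord i j k)) :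
    ∃ l < k, t = (cs.simple j * cs.simple i) ^ l * cs.simple j := by
  induction k generalizing i j t with
  | zero => simp [alternatingWord] at ht
  | succ k ih =>
    rw [alternatingWord_succ, rightInvSeq_concat] at ht
    simp only [List.concat_eq_append, List.mem_append, List.mem_map, List.mem_singleton] at ht
    obtain ⟨t', ht', rfl⟩ | rfl := ht
    · obtain ⟨l, hl, rfl⟩ := ih ht'
      refine ⟨l + 1, by lia, ?_⟩
      rw [MulAut.conj_apply, inv_simple, mul_pow_mul]
      simp only [pow_succ', mul_assoc]
    · exact ⟨0, by lia, by simp⟩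

theorem wordProd_eq_wordProd_append_simple {u v : List B} {i : B}
    (h : cs.simple i ∈ cs.rightInvSeq (u ++ v)) (hv : cs.simple i ∉ cs.rightInvSeq v) :
    ∃ u' : List B, u'.length + 1 = u.length ∧
      cs.wordProd (u' ++ v.concat i) = cs.wordProd (u ++ v) := by
  obtain ⟨p, hp, hpi⟩ := List.mem_iff_getElem.1 h
  have hpu : p < u.length := by
    by_contra hle
    apply hv
    have hd := cs.rightInvSeq_drop (u ++ v) u.length
    rw [List.drop_left] at hd
    rw [hd, ← hpi, List.mem_drop_iff_getElem]
    exact ⟨p - u.length, by lia, by congr 1; lia⟩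
  have he := cs.wordProd_mul_getD_rightInvSeq (u ++ v) p
  rw [List.getD_eq_getElem _ _ hp, hpi, List.eraseIdx_append_of_lt_length hpu] at he
  refine ⟨u.eraseIdx p, List.length_eraseIdx_add_one hpu, ?_⟩
  rw [List.concat_eq_append, ← List.append_assoc, ← List.concat_eq_append, wordProd_concat, ← he]
  simp

/-- An element with two right descents has a reduced word ending with a long alternating word. -/
theorem exists_isReduced_append_alternatingWord {w : W} {i j : B} (hij : i ≠ j)
    (hi : cs.IsRightDescent w i) (hj : cs.IsRightDescent w j) (k : ℕ)
    (hk : M i j = 0 ∨ k ≤ M i j) :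
    ∃ ζ : List B, ζ ++ alternatingWord i j k ∈ cs.reducedWords w ∨
      ζ ++ alternatingWord j i k ∈ cs.reducedWords w := by
  -- If `s_i` were an inversion of the alternating suffix, some `(s_j s_i)^(l+1)` with `l + 1 ≤ k`
  -- would be trivial, against the order being `m`. So the exchange deletes a letter of `ζ` and
  -- appends `i`, lengthening the suffix.
  have key : ∀ (i j : B) (ζ : List B) (k : ℕ), i ≠ j → cs.IsRightDescent w i →
      (M i j = 0 ∨ k < M i j) → ζ ++ alternatingWord i j k ∈ cs.reducedWords w →
      ∃ ζ' : List B, ζ' ++ alternatingWord j i (k + 1) ∈ cs.reducedWords w := by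
    rintro i j ζ k hij hi hk ⟨hred, hw⟩
    have hn : cs.simple i ∉ cs.rightInvSeq (alternatingWord i j k) := by
      intro hmem
      obtain ⟨l, hl, h⟩ := cs.exists_pow_mul_of_mem_rightInvSeq_alternatingWord hmem
      have h1 : (cs.simple j * cs.simple i) ^ (l + 1) = 1 := by
        rw [pow_succ, ← mul_assoc, ← h, simple_mul_simple_self]
      have hd := cs.dvd_of_simple_mul_simple_pow_eq_one hij.symm h1
      rw [M.symmetric] at hd
      have := Nat.le_of_dvd (by lia) hd
      rcases hk with hk | hk
      · rw [hk] at hd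
        simp at hd
      · lia
    obtain ⟨ζ', hl, h⟩ := cs.wordProd_eq_wordProd_append_simple
      (hi.simple_mem_rightInvSeq hw) hn
    refine ⟨ζ', ?_, h.trans hw⟩
    rw [alternatingWord_succ, IsReduced, h, hred.eq]
    simp [← hl]
    lia
  induction k with
  | zero =>
    obtain ⟨ω, hω, rfl⟩ := cs.exists_isReduced w
    exact ⟨ω, .inl ⟨by simpa [alternatingWord] using hω, by simp [alternatingWord]⟩⟩
  | succ k ih =>
    obtain ⟨ζ, h | h⟩ := ih (by lia)
    · obtain ⟨ζ', h'⟩ := key i j ζ k hij hi (by lia) h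
      exact ⟨ζ', .inr h'⟩
    · obtain ⟨ζ', h'⟩ := key j i ζ k hij.symm hj (by rw [M.symmetric]; lia) h
      exact ⟨ζ', .inl h'⟩

/-- An element with two right descents has reduced words ending with the two braid words. -/
theorem exists_append_braidWord_mem_reducedWords {w : W} {i j : B} (hij : i ≠ j)
    (hi : cs.IsRightDescent w i) (hj : cs.IsRightDescent w j) :
    M i j ≠ 0 ∧ ∃ ζ : List B, ζ ++ alternatingWord i j (M i j) ∈ cs.reducedWords w ∧
      ζ ++ alternatingWord j i (M i j) ∈ cs.reducedWords w := by
  have h0 : M i j ≠ 0 := by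
    intro h0
    -- With `m = ∞` the alternating suffix could be longer than `w`.
    obtain ⟨ζ, h | h⟩ := cs.exists_isReduced_append_alternatingWord hij hi hj
      (cs.length w + 1) (.inl h0)
    all_goals
      have := h.1.eq
      rw [h.2] at this
      simp at this
      lia
  refine ⟨h0, ?_⟩
  have hb : cs.wordProd (alternatingWord i j (M i j)) =
      cs.wordProd (alternatingWord j i (M i j)) := by
    rw [cs.wordProd_braidWord_eq, braidWord, M.symmetric]
  have hswap (ζ : List B) : ζ ++ alternatingWord i j (M i j) ∈ cs.reducedWords w ↔
      ζ ++ alternatingWord j i (M i j) ∈ cs.reducedWords w := by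
    simp [reducedWords, IsReduced, wordProd_append, hb]
  obtain ⟨ζ, h | h⟩ := cs.exists_isReduced_append_alternatingWord hij hi hj (M i j) (.inr le_rfl)
  · exact ⟨ζ, h, (hswap ζ).1 h⟩
  · exact ⟨ζ, (hswap ζ).2 h, h⟩

/-! ### Fully commutative elements through forbidden factors. -/

/-- The factors that reduced words of fully commutative elements avoid: squares of letters and
braid words of length at least `3`. -/
def forbiddenWords (M : CoxeterMatrix B) : Set (List B) :=
  (Set.range fun s => [s, s]) ∪
    (fun p : B × B => alternatingWord p.1 p.2 (M p.1 p.2)) '' {p | 3 ≤ M p.1 p.2}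

theorem finite_forbiddenWords [Finite B] : (forbiddenWords M).Finite :=
  (Set.finite_range _).union (Set.toFinite _)

/-- The reduced words of fully commutative elements. -/
def fcWords : Set (List B) :=
  {ω | cs.IsReduced ω ∧ cs.IsFullyCommutative (cs.wordProd ω)}

theorem wordProd_eq_of_commEquiv {ω ω' : List B} (h : CommEquiv M ω ω') :
    cs.wordProd ω = cs.wordProd ω' := by
  induction h with
  | refl => rfl
  | tail _ h ih =>
    obtain ⟨u, v, s, t, hst, rfl, rfl⟩ := h
    have hb := cs.wordProd_braidWord_eq s t
    rw [braidWord, braidWord, M.symmetric t s, hst] at hb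
    simp only [alternatingWord, List.concat_eq_append, List.nil_append, List.cons_append,
      wordProd_cons, wordProd_nil, mul_one] at hb
    rw [ih]
    simp only [wordProd_append, wordProd_cons]
    rw [← mul_assoc (cs.simple s), hb, mul_assoc]

theorem mem_reducedWords_of_commEquiv {ω ω' : List B} (h : CommEquiv M ω ω')
    (hω : cs.IsReduced ω) : ω' ∈ cs.reducedWords (cs.wordProd ω) := by
  have hp := cs.wordProd_eq_of_commEquiv h
  refine ⟨?_, hp.symm⟩
  rw [IsReduced, ← hp, hω.eq, h.length_eq]

theorem commClosed_fcWords : CommClosed M cs.fcWords := by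
  rintro ω ω' h ⟨hred, hfc⟩
  exact ⟨(cs.mem_reducedWords_of_commEquiv h hred).1, cs.wordProd_eq_of_commEquiv h ▸ hfc⟩

theorem mem_fcWords_of_forall {ω : List B} (hω : cs.IsReduced ω)
    (h : ∀ ω' ∈ cs.reducedWords (cs.wordProd ω), CommEquiv M ω ω') : ω ∈ cs.fcWords :=
  ⟨hω, fun ω₁ h₁ ω₂ h₂ => (h ω₁ h₁).symm.trans (h ω₂ h₂)⟩

theorem commEquiv_of_mem_fcWords {ω ω' : List B} (hω : ω ∈ cs.fcWords)
    (h : ω' ∈ cs.reducedWords (cs.wordProd ω)) : CommEquiv M ω ω' :=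
  hω.2 ω ⟨hω.1, rfl⟩ ω' h

theorem isReduced_of_isReduced_append {u v : List B} (h : cs.IsReduced (u ++ v)) :
    cs.IsReduced u := by
  simpa using h.take u.length

theorem isRightDescent_of_isReduced_append {u : List B} {i : B} (h : cs.IsReduced (u ++ [i])) :
    cs.IsRightDescent (cs.wordProd (u ++ [i])) i := by
  have hu := cs.isReduced_of_isReduced_append h
  rw [IsRightDescent, h.eq, ← List.concat_eq_append, wordProd_concat,
    simple_mul_simple_cancel_right, hu.eq]
  simp

/-- A word whose commutation class has no forbidden factor is a reduced word of a fully
commutative element. -/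
theorem mem_fcWords_of_notMem_commFactorSet {ω : List B}
    (hω : ω ∉ commFactorSet M (forbiddenWords M)) : ω ∈ cs.fcWords := by
  induction hn : ω.length generalizing ω with
  | zero =>
    obtain rfl := List.length_eq_zero_iff.1 hn
    refine cs.mem_fcWords_of_forall (by simp [IsReduced]) ?_
    rintro ω' ⟨hred, hw⟩
    have := hred.eq
    rw [hw] at this
    simp at this
    rw [List.length_eq_zero_iff.1 this.symm]
    exact CommEquiv.refl _
  | succ n ih =>
    obtain rfl | ⟨ν, s, rfl⟩ := ω.eq_nil_or_concat'
    · simp at hn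
    have hmono {ν' : List B} {t : B} (h : CommEquiv M (ν ++ [s]) (ν' ++ [t])) :
        ν' ∈ cs.fcWords := by
      refine ih ?_ ?_
      · rintro ⟨b, hb, x, y, hxy⟩
        exact hω ⟨b, hb, x, y ++ [t], by simpa using h.trans (hxy.append_right [t])⟩
      · have := h.length_eq
        simp at this hn
        lia
    have hν : ν ∈ cs.fcWords := hmono (CommEquiv.refl _)
    have hwν : cs.wordProd (ν ++ [s]) = cs.wordProd ν * cs.simple s := by
      rw [← List.concat_eq_append, wordProd_concat]
    have hred : cs.IsReduced (ν ++ [s]) := by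
      obtain h | h := cs.length_mul_simple (cs.wordProd ν) s
      · rw [IsReduced, hwν, h, hν.1.eq]
        simp
      · exfalso
        obtain ⟨μ, hμ, hμν⟩ := cs.exists_isReduced (cs.wordProd ν * cs.simple s)
        -- If `ν s` were not reduced, `ν` would be equivalent to a word ending in `s`, and `ν s` to
        -- one ending in `ss`.
        have hμs : μ ++ [s] ∈ cs.reducedWords (cs.wordProd ν) := by
          have hw : cs.wordProd (μ ++ [s]) = cs.wordProd ν := by
            rw [← List.concat_eq_append, wordProd_concat, ← hμν, simple_mul_simple_cancel_right]
          refine ⟨?_, hw⟩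
          rw [IsReduced, hw, ← h, hμν, hμ.eq]
          simp
        refine hω ⟨[s, s], .inl ⟨s, rfl⟩, μ, [], ?_⟩
        simpa using (cs.commEquiv_of_mem_fcWords hν hμs).append_right [s]
    refine cs.mem_fcWords_of_forall hred ?_
    rintro ω' hω'
    obtain rfl | ⟨μ, t, rfl⟩ := ω'.eq_nil_or_concat'
    · have := hred.eq
      rw [← hω'.2] at this
      simp at this
    obtain ⟨hred', hw⟩ := hω'
    have hwμ : cs.wordProd (μ ++ [t]) = cs.wordProd μ * cs.simple t := by
      rw [← List.concat_eq_append, wordProd_concat]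
    have hμ := cs.isReduced_of_isReduced_append hred'
    obtain rfl | hst := eq_or_ne s t
    · refine CommEquiv.append_right [s] (cs.commEquiv_of_mem_fcWords hν ⟨hμ, ?_⟩)
      rw [hwμ, hwν] at hw
      exact mul_right_cancel hw
    have hs := cs.isRightDescent_of_isReduced_append hred
    have ht := cs.isRightDescent_of_isReduced_append hred'
    rw [hw] at ht
    obtain ⟨h0, ζ, h₁, h₂⟩ := cs.exists_append_braidWord_mem_reducedWords hst hs ht
    obtain ⟨m, hm⟩ := Nat.exists_eq_succ_of_ne_zero h0
    -- The braid word ending in `s` is reached from `ν s` by commutations, because cancelling the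
    -- last `s` leaves two reduced words of the same fully commutative element.
    have hνζ : CommEquiv M (ν ++ [s]) (ζ ++ alternatingWord t s (M s t)) := by
      rw [hm, Nat.succ_eq_add_one, alternatingWord_succ, List.concat_eq_append,
        ← List.append_assoc] at h₂ ⊢
      refine CommEquiv.append_right [s] (cs.commEquiv_of_mem_fcWords hν
        ⟨cs.isReduced_of_isReduced_append h₂.1, ?_⟩)
      have := h₂.2
      rw [hwν, ← List.concat_eq_append, wordProd_concat] at this
      exact mul_right_cancel this
    have h1 : M s t ≠ 1 := M.off_diagonal s t hst
    obtain h2 | h3 : M s t = 2 ∨ 3 ≤ M s t := by lia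
    · rw [h2] at hνζ h₁
      simp only [alternatingWord, List.concat_eq_append, List.nil_append,
        List.cons_append] at hνζ h₁
      -- When `m = 2`, one swap makes `t` the last letter, and the prefix `ζ s` is again fully
      -- commutative by induction, hence equivalent to `μ`.
      have hνζ' : CommEquiv M (ν ++ [s]) ((ζ ++ [s]) ++ [t]) := by
        refine hνζ.trans ?_
        simpa using CommEquiv.swap (by rwa [M.symmetric]) ζ []
      refine hνζ'.trans (CommEquiv.append_right [t]
        (cs.commEquiv_of_mem_fcWords (hmono hνζ') ⟨hμ, ?_⟩))
      have h := hw.trans h₁.2.symm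
      rw [hwμ, show ζ ++ [s, t] = (ζ ++ [s]).concat t by simp, wordProd_concat] at h
      exact mul_right_cancel h
    · refine absurd ⟨alternatingWord t s (M s t), .inr ⟨(t, s), ?_, ?_⟩, ζ, [], by simpa using hνζ⟩
        hω
      · simpa [M.symmetric t s] using h3
      · simp [M.symmetric t s]

-- Two letters from `{s, t}` are never exchanged. This invariant tells apart the two braid words on
-- `s` and `t`.
open Classical in
theorem CommEquiv.filter_eq {s t : B} (hst : M s t ≠ 2) {ω ω' : List B} (h : CommEquiv M ω ω') :
    ω.filter (fun c => c = s ∨ c = t) = ω'.filter (fun c => c = s ∨ c = t) := by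
  induction h with
  | refl => rfl
  | tail _ h ih =>
    obtain ⟨u, v, a, b, hab, rfl, rfl⟩ := h
    rw [ih]
    have hn : ¬((a = s ∨ a = t) ∧ (b = s ∨ b = t)) := by
      rintro ⟨rfl | rfl, rfl | rfl⟩
      · simp at hab
      · exact hst hab
      · exact hst (by rwa [M.symmetric])
      · simp at hab
    simp only [List.filter_append, List.filter_cons, decide_eq_true_eq]
    split_ifs <;> simp_all

theorem mem_or_of_mem_alternatingWord {i j c : B} {k : ℕ} (h : c ∈ alternatingWord i j k) :
    c = i ∨ c = j := by
  induction k generalizing i j with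
  | zero => simp [alternatingWord] at h
  | succ k ih =>
    simp only [alternatingWord, List.concat_eq_append, List.mem_append, List.mem_singleton] at h
    rcases h with h | h
    · exact (ih h).symm
    · exact .inr h

/-- A square contradicts reducedness. A braid move on a long braid word gives another reduced word
whose subword on `{s, t}` differs, so commutations cannot reach it. -/
theorem notMem_commFactorSet_of_mem_fcWords {ω : List B} (hω : ω ∈ cs.fcWords) :
    ω ∉ commFactorSet M (forbiddenWords M) := by
  classical
  rintro ⟨b, hb, x, y, h⟩
  obtain ⟨hred, hfc⟩ := cs.commClosed_fcWords h hω
  obtain ⟨s, rfl⟩ | ⟨⟨s, t⟩, h3, rfl⟩ := hb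
  · have h1 := hred.eq
    have h2 := cs.length_wordProd_le (x ++ y)
    rw [show cs.wordProd (x ++ [s, s] ++ y) = cs.wordProd (x ++ y) by
      simp [wordProd_append, wordProd_cons]] at h1
    simp at h1 h2
    lia
  · simp only [Set.mem_ofPred_eq] at h3
    have hb : cs.wordProd (alternatingWord s t (M s t)) =
        cs.wordProd (alternatingWord t s (M s t)) := by
      rw [cs.wordProd_braidWord_eq, braidWord, M.symmetric]
    have hmem : x ++ alternatingWord t s (M s t) ++ y ∈
        cs.reducedWords (cs.wordProd (x ++ alternatingWord s t (M s t) ++ y)) := by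
      have hw : cs.wordProd (x ++ alternatingWord t s (M s t) ++ y) =
          cs.wordProd (x ++ alternatingWord s t (M s t) ++ y) := by
        simp [wordProd_append, hb]
      refine ⟨?_, hw⟩
      rw [IsReduced, hw, hred.eq]
      simp
    have hf := (hfc _ ⟨hred, rfl⟩ _ hmem).filter_eq (s := s) (t := t) (by lia)
    simp only [List.filter_append, List.append_cancel_left_eq, List.append_cancel_right_eq] at hf
    rw [List.filter_eq_self.2, List.filter_eq_self.2] at hf
    · obtain ⟨m, hm⟩ := Nat.exists_eq_succ_of_ne_zero (show M s t ≠ 0 by lia)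
      rw [hm, Nat.succ_eq_add_one, alternatingWord_succ, alternatingWord_succ] at hf
      obtain rfl : t = s := by simpa using congrArg List.getLast? hf
      simp at h3
    · intro c hc
      simpa using (mem_or_of_mem_alternatingWord hc).symm
    · intro c hc
      simpa using mem_or_of_mem_alternatingWord hc

theorem mem_fcWords_iff {ω : List B} :
    ω ∈ cs.fcWords ↔ ω ∉ commFactorSet M (forbiddenWords M) :=
  ⟨cs.notMem_commFactorSet_of_mem_fcWords, cs.mem_fcWords_of_notMem_commFactorSet⟩

/-! ### Cyclically fully commutative words. -/

/-- The reduced words of a fully commutative element form one commutation class, so the quantifier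
over reduced words becomes one over words equivalent to `ω`. -/
theorem mem_cfcWords_iff {ω : List B} :
    ω ∈ cs.cfcWords ↔ ∀ ω', CommEquiv M ω ω' → ∀ ω'', ω'.IsRotated ω'' → ω'' ∈ cs.fcWords := by
  constructor
  · rintro ⟨_, hw, hred, rfl⟩ ω' h ω'' hrot
    exact hw ω' (cs.mem_reducedWords_of_commEquiv h hred) ω'' hrot
  · intro h
    have hω : ω ∈ cs.fcWords := h ω (CommEquiv.refl _) ω (List.IsRotated.refl _)
    exact ⟨_, fun ω' hω' ω'' hrot => h ω' (cs.commEquiv_of_mem_fcWords hω hω') ω'' hrot,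
      hω.1, rfl⟩

theorem cfcWords_eq_compl :
    cs.cfcWords =
      {ω | ∃ u v, CommEquiv M ω (u ++ v) ∧ v ++ u ∈ commFactorSet M (forbiddenWords M)}ᶜ := by
  ext ω
  rw [mem_cfcWords_iff]
  constructor
  · rintro h ⟨u, v, huv, hvu⟩
    exact cs.mem_fcWords_iff.1 (h _ huv _ ⟨u.length, by simp⟩) hvu
  · rintro h ω' hω' _ ⟨n, rfl⟩
    rw [mem_fcWords_iff]
    intro hbad
    refine h ⟨ω'.take (n % ω'.length), ω'.drop (n % ω'.length), by simpa using hω', ?_⟩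
    rwa [List.rotate_eq_drop_append_take_mod] at hbad

theorem hasFiniteQuotients_cfcWords [Finite B] : HasFiniteQuotients cs.cfcWords := by
  rw [cfcWords_eq_compl]
  exact (hasFiniteQuotients_rotation (commClosed_commFactorSet _)
    (hasFiniteQuotients_commFactorSet finite_forbiddenWords)).compl

end CoxeterSystem

theorem mainTheorem3 {B W : Type*} [Finite B] [Group W] {M : CoxeterMatrix B}
    (cs : CoxeterSystem M W) :
    (wordGeneratingSeries cs.cfcWords).IsRationalSeries :=
  cs.hasFiniteQuotients_cfcWords.isRationalSeries
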